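/- Let $q$ be a complex number with $|q|<1$ and let $k$ be a positive integer. Write $(a;q)_0=1$, $(a;q)_n=\prod_{l=0}^{n-1}(1-aq^l)$ for $n\ge 1$, and $(a;q)_\infty=\prod_{l=0}^{\infty}(1-aq^l)$. Then $$\frac{1}{(q;q)_{\infty}}\sum_{n=k}^{\infty}(-1)^{n-k}\frac{2n+1}{2k+1}\binom{n+k}{2k}q^{\frac{n(n+1)}{2}}=\sum_{i=0}^{\infty}\sum_{j=i+k}^{\infty}(-1)^{j-i-k}\frac{j-i}{k}\binom{j-i+k-1}{2k-1}\frac{q^{\frac{i(i+1)}{2}+\frac{j(j+1)}{2}}}{(q;q)_i(q;q)_j}$$ and $$\frac{1}{(q^2;q^2)_{\infty}}\sum_{n=k}^{\infty}(-1)^{n-k}\frac{2n}{n+k}\binom{n+k}{2k}q^{n^2}=\sum_{i=0}^{\infty}\sum_{j=i+k}^{\infty}(-1)^{j-i-k}\frac{j-i}{k}\binom{j-i+k-1}{2k-1}\frac{q^{i^2+j^2}}{(q^2;q^2)_i(q^2;q^2)_j}.$$ Here the infinite products converge and are nonzero, and all the single and double series converge absolutely. -/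

import Mathlib

noncomputable section

/-- The finite `q`-shifted factorial `(a; q)_n = ∏_{i < n} (1 - a q ^ i)`, with `(a; q)_0 = 1`. -/
def qShifted (a q : ℂ) (n : ℕ) : ℂ := ∏ i ∈ Finset.range n, (1 - a * q ^ i)

/-- The infinite `q`-shifted factorial `(a; q)_∞ = ∏_{i ≥ 0} (1 - a q ^ i)`. -/
def qShiftedInf (a q : ℂ) : ℂ := ∏' i : ℕ, (1 - a * q ^ i)

/-- The `n`-th term (used for `n ≥ k`) of the single series in the first identity. -/
def singleTermA (k : ℕ) (q : ℂ) (n : ℕ) : ℂ :=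
  (-1) ^ (n - k) * ((2 * (n : ℂ) + 1) / (2 * (k : ℂ) + 1)) * (Nat.choose (n + k) (2 * k) : ℂ)
    * q ^ (n * (n + 1) / 2)

/-- The `n`-th term (used for `n ≥ k`) of the single series in the second identity. -/
def singleTermC (k : ℕ) (q : ℂ) (n : ℕ) : ℂ :=
  (-1) ^ (n - k) * (2 * (n : ℂ) / ((n : ℂ) + (k : ℂ))) * (Nat.choose (n + k) (2 * k) : ℂ)
    * q ^ (n ^ 2)

/-- The `(i, j)`-th term (used for `j ≥ i + k`) of the double series in the first identity. -/
def doubleTermA (k : ℕ) (q : ℂ) (i j : ℕ) : ℂ :=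
  (-1) ^ (j - i - k) * (((j : ℂ) - (i : ℂ)) / (k : ℂ))
    * (Nat.choose (j - i + k - 1) (2 * k - 1) : ℂ)
    * (q ^ (i * (i + 1) / 2 + j * (j + 1) / 2) / (qShifted q q i * qShifted q q j))

/-- The `(i, j)`-th term (used for `j ≥ i + k`) of the double series in the second identity. -/
def doubleTermC (k : ℕ) (q : ℂ) (i j : ℕ) : ℂ :=
  (-1) ^ (j - i - k) * (((j : ℂ) - (i : ℂ)) / (k : ℂ))
    * (Nat.choose (j - i + k - 1) (2 * k - 1) : ℂ)
    * (q ^ (i ^ 2 + j ^ 2) / (qShifted (q ^ 2) (q ^ 2) i * qShifted (q ^ 2) (q ^ 2) j))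

end

/-!
Write `m = j - i` for the difference of the two summation indices of a double series. Summing over
`i` first turns the right-hand side into `∑_{m ≥ k} (-1)^(m-k) a_m c_m`, where
`a_m = (m / k) * (m + k - 1).choose (2 * k - 1)` and `c_m` is the `m`-th Laurent coefficient of a
product of two Euler series.

For the second identity `c_m = q ^ m² * ∑_i p ^ (i (i + m)) / ((p; p)_i (p; p)_{i+m})` with
`p = q²`, and the remaining sum is `1 / (p; p)_∞` for every `m` by the Durfee rectangle identity
(`tsum_durfeeTerm_zero`). As `a_m = 2 m / (m + k) * (m + k).choose (2 * k)`, this is the single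
series.

The Durfee rectangle identity itself is proved analytically: the sums `D_n` satisfy
`D_n - D_{n+1} = -p ^ (n+1) (D_{n+1} - D_{n+2})`, so `‖D_n - D_{n+1}‖` is nondecreasing in `n`;
since `D_n` converges to `1 / (p; p)_∞` by dominated convergence, the differences vanish.

For the first identity the coefficients satisfy `c_m + c_{m+1} = q ^ (m (m + 1) / 2) / (q; q)_∞`,
which again follows from the Durfee rectangle identity. The partial sums of `a_k, a_{k+1}, …` are
`(2 n + 1) / (2 k + 1) * (n + k).choose (2 * k)`, so the identity follows by summation by parts.
-/

open Filter Topology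

/-! ### The q-shifted factorial `(p; p)_n` -/

lemma qShifted_succ (p : ℂ) (n : ℕ) :
    qShifted p p (n + 1) = qShifted p p n * (1 - p ^ (n + 1)) := by
  simp [qShifted, Finset.prod_range_succ, pow_succ']

lemma one_sub_pow_succ_ne_zero {p : ℂ} (hp : ‖p‖ < 1) (n : ℕ) : 1 - p ^ (n + 1) ≠ 0 := by
  intro h
  have h1 : ‖p ^ (n + 1)‖ < 1 := by
    rw [norm_pow]; exact pow_lt_one₀ (norm_nonneg _) hp n.succ_ne_zero
  rw [← sub_eq_zero.1 h, norm_one] at h1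
  exact lt_irrefl _ h1

lemma qShifted_ne_zero {p : ℂ} (hp : ‖p‖ < 1) (n : ℕ) : qShifted p p n ≠ 0 := by
  refine Finset.prod_ne_zero_iff.2 fun i _ => ?_
  rw [← pow_succ']
  exact one_sub_pow_succ_ne_zero hp i

lemma summable_norm_neg_mul_pow {p : ℂ} (hp : ‖p‖ < 1) :
    Summable fun i : ℕ => ‖-(p * p ^ i)‖ := by
  simp only [norm_neg, norm_mul, norm_pow]
  exact (summable_geometric_of_lt_one (norm_nonneg _) hp).mul_left _

lemma multipliable_one_sub_mul_pow {p : ℂ} (hp : ‖p‖ < 1) :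
    Multipliable fun i : ℕ => 1 - p * p ^ i := by
  simpa [sub_eq_add_neg] using multipliable_one_add_of_summable (summable_norm_neg_mul_pow hp)

lemma qShiftedInf_ne_zero {p : ℂ} (hp : ‖p‖ < 1) : qShiftedInf p p ≠ 0 := by
  have := tprod_one_add_ne_zero_of_summable (f := fun i : ℕ => -(p * p ^ i))
    (fun i => by
      rw [← sub_eq_add_neg, ← pow_succ']; exact one_sub_pow_succ_ne_zero hp i)
    (summable_norm_neg_mul_pow hp)
  simpa [qShiftedInf, sub_eq_add_neg] using this

lemma tendsto_inv_qShifted {p : ℂ} (hp : ‖p‖ < 1) :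
    Tendsto (fun n => (qShifted p p n)⁻¹) atTop (𝓝 (qShiftedInf p p)⁻¹) :=
  ((multipliable_one_sub_mul_pow hp).tendsto_prod_tprod_nat).inv₀ (qShiftedInf_ne_zero hp)

lemma exists_norm_inv_qShifted_le {p : ℂ} (hp : ‖p‖ < 1) :
    ∃ C : ℝ, 0 ≤ C ∧ ∀ n, ‖(qShifted p p n)⁻¹‖ ≤ C := by
  obtain ⟨C, hC⟩ := (Metric.isBounded_range_of_tendsto _ (tendsto_inv_qShifted hp)).exists_norm_le
  exact ⟨C, (norm_nonneg _).trans (hC _ ⟨0, rfl⟩), fun n => hC _ ⟨n, rfl⟩⟩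

lemma exists_norm_pow_div_qShifted_mul_le {p : ℂ} (hp : ‖p‖ < 1) :
    ∃ C : ℝ, 0 ≤ C ∧ ∀ (q : ℂ) (e d i j : ℕ), ‖q‖ < 1 → d ≤ e →
      ‖q ^ e / (qShifted p p i * qShifted p p j)‖ ≤ C * ‖q‖ ^ d := by
  obtain ⟨C, hC, h⟩ := exists_norm_inv_qShifted_le hp
  refine ⟨C * C, mul_nonneg hC hC, fun q e d i j hq hd => ?_⟩
  rw [div_eq_mul_inv, mul_inv, norm_mul, norm_mul, norm_pow, mul_comm]
  exact mul_le_mul (mul_le_mul (h i) (h j) (norm_nonneg _) hC)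
    (pow_le_pow_of_le_one (norm_nonneg _) hq.le hd) (by positivity) (mul_nonneg hC hC)

/-! ### Durfee rectangle sums -/

/-- The `i`-th term `p ^ (i (i + n + r)) / ((p; p)_i (p; p)_{i+n})` of the Durfee rectangle sum with
excess `n`. For `r = 0` the sum over `i` is `1 / (p; p)_∞`; the case `r = 1` occurs in the Laurent
coefficients of the first identity. -/
noncomputable def durfeeTerm (p : ℂ) (r n i : ℕ) : ℂ :=
  p ^ (i * (i + n + r)) / (qShifted p p i * qShifted p p (i + n))

lemma le_mul_add_add (i n r : ℕ) : i ≤ i * (i + n + r) := by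
  rcases Nat.eq_zero_or_pos i with rfl | h
  · simp
  · exact Nat.le_mul_of_pos_right _ (by omega)

lemma summable_durfeeTerm {p : ℂ} (hp : ‖p‖ < 1) (r n : ℕ) : Summable (durfeeTerm p r n) := by
  obtain ⟨C, -, h⟩ := exists_norm_pow_div_qShifted_mul_le hp
  exact Summable.of_norm_bounded
    ((summable_geometric_of_lt_one (norm_nonneg _) hp).mul_left C)
    fun i => h p _ _ _ _ hp (le_mul_add_add i n r)

lemma tendsto_tsum_durfeeTerm_zero {p : ℂ} (hp : ‖p‖ < 1) :
    Tendsto (fun n => ∑' i, durfeeTerm p 0 n i) atTop (𝓝 (qShiftedInf p p)⁻¹) := by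
  obtain ⟨C, hC, h⟩ := exists_norm_pow_div_qShifted_mul_le hp
  have key := tendsto_tsum_of_dominated_convergence (𝓕 := atTop)
    (f := fun n i => durfeeTerm p 0 n i)
    (g := fun i : ℕ => if i = 0 then (qShiftedInf p p)⁻¹ else 0)
    ((summable_geometric_of_lt_one (norm_nonneg _) hp).mul_left C)
    (fun i => ?_)
    (Eventually.of_forall fun n i => h p _ _ _ _ hp (le_mul_add_add i n 0))
  · simpa using key
  rcases Nat.eq_zero_or_pos i with rfl | hi
  · simpa [durfeeTerm, qShifted] using tendsto_inv_qShifted hp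
  · rw [if_neg hi.ne']
    -- for `i ≥ 1` the exponent is at least `n`
    refine squeeze_zero_norm (fun n => h p _ n _ _ hp ?_)
      (by simpa using (tendsto_pow_atTop_nhds_zero_of_lt_one (norm_nonneg p) hp).const_mul C)
    nlinarith

/-- Three-term recurrence of the Durfee rectangle sums, obtained by cancelling the
factor `1 - p ^ i` of `(p; p)_i` and shifting the index. -/
lemma tsum_durfeeTerm_zero_recurrence {p : ℂ} (hp : ‖p‖ < 1) (n : ℕ) :
    ∑' i, durfeeTerm p 0 n i = (1 - p ^ (n + 1)) * ∑' i, durfeeTerm p 0 (n + 1) i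
      + p ^ (n + 1) * ∑' i, durfeeTerm p 0 (n + 2) i := by
  have h0 : durfeeTerm p 0 n 0 = (1 - p ^ (n + 1)) * durfeeTerm p 0 (n + 1) 0 := by
    have h1 := qShifted_ne_zero hp n
    have h2 := one_sub_pow_succ_ne_zero hp n
    simp only [durfeeTerm, zero_add, qShifted_succ, zero_mul, pow_zero]
    field_simp
  have hs : ∀ i, durfeeTerm p 0 n (i + 1) = (1 - p ^ (n + 1)) * durfeeTerm p 0 (n + 1) (i + 1)
      + p ^ (n + 1) * durfeeTerm p 0 (n + 2) i := by
    intro i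
    have h1 := qShifted_ne_zero hp i
    have h2 := one_sub_pow_succ_ne_zero hp i
    have h3 := qShifted_ne_zero hp (i + n + 1)
    have h4 := one_sub_pow_succ_ne_zero hp (i + n + 1)
    have e1 : i + 1 + n = i + n + 1 := by ring
    have e2 : i + 1 + (n + 1) = i + n + 1 + 1 := by ring
    have e3 : i + (n + 2) = i + n + 1 + 1 := by ring
    simp only [durfeeTerm, e1, e2, e3]
    rw [qShifted_succ p i, qShifted_succ p (i + n + 1)]
    field_simp
    ring
  have s0 := summable_durfeeTerm hp 0 n
  have s1 := summable_durfeeTerm hp 0 (n + 1)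
  have s2 := summable_durfeeTerm hp 0 (n + 2)
  rw [s0.tsum_eq_zero_add, s1.tsum_eq_zero_add, h0, tsum_congr hs,
    (((summable_nat_add_iff 1).2 s1).mul_left _).tsum_add (s2.mul_left _), tsum_mul_left,
    tsum_mul_left]
  ring

/-- The Durfee rectangle identity. -/
lemma tsum_durfeeTerm_zero {p : ℂ} (hp : ‖p‖ < 1) (n : ℕ) :
    ∑' i, durfeeTerm p 0 n i = (qShiftedInf p p)⁻¹ := by
  set D : ℕ → ℂ := fun n => ∑' i, durfeeTerm p 0 n i with hD
  have hlim : Tendsto D atTop (𝓝 (qShiftedInf p p)⁻¹) := tendsto_tsum_durfeeTerm_zero hp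
  have hmono : Monotone fun n => ‖D n - D (n + 1)‖ := by
    refine monotone_nat_of_le_succ fun n => ?_
    have h : D n - D (n + 1) = -p ^ (n + 1) * (D (n + 1) - D (n + 2)) := by
      linear_combination tsum_durfeeTerm_zero_recurrence hp n
    rw [h, norm_mul, norm_neg, norm_pow]
    exact mul_le_of_le_one_left (norm_nonneg _) (pow_le_one₀ (norm_nonneg _) hp.le)
  have hdiff : Tendsto (fun n => ‖D n - D (n + 1)‖) atTop (𝓝 0) := by
    simpa using (hlim.sub (hlim.comp (tendsto_add_atTop_nat 1))).norm
  have hstep : ∀ n, D (n + 1) = D n := fun n =>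
    (sub_eq_zero.1 (norm_le_zero_iff.1 (hmono.ge_of_tendsto hdiff n))).symm
  have hconst : ∀ m, D m = D 0 := fun m => by
    induction m with
    | zero => rfl
    | succ m ih => rw [hstep, ih]
  have h0 : D 0 = (qShiftedInf p p)⁻¹ :=
    tendsto_nhds_unique (tendsto_const_nhds.congr fun m => (hconst m).symm) hlim
  exact (hconst n).trans h0

/-- The case `r = 1` is linked to the Durfee rectangle identity by splitting the numerator of the
`r = 0` term as `p ^ i + (1 - p ^ i)`. -/
lemma tsum_durfeeTerm_one_add {p : ℂ} (hp : ‖p‖ < 1) (n : ℕ) :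
    ∑' i, durfeeTerm p 1 n i + p ^ (n + 1) * ∑' i, durfeeTerm p 1 (n + 1) i
      = (qShiftedInf p p)⁻¹ := by
  have h0 : durfeeTerm p 0 n 0 = durfeeTerm p 1 n 0 := by simp [durfeeTerm]
  have hs : ∀ i, durfeeTerm p 0 n (i + 1) = durfeeTerm p 1 n (i + 1)
      + p ^ (n + 1) * durfeeTerm p 1 (n + 1) i := by
    intro i
    have h1 := qShifted_ne_zero hp i
    have h2 := one_sub_pow_succ_ne_zero hp i
    have h3 := qShifted_ne_zero hp (i + n + 1)
    have e1 : i + 1 + n = i + n + 1 := by ring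
    have e2 : i + (n + 1) = i + n + 1 := by ring
    simp only [durfeeTerm, e1, e2]
    rw [qShifted_succ p i]
    field_simp
    ring
  have s0 := summable_durfeeTerm hp 0 n
  have s1 := summable_durfeeTerm hp 1 n
  have s2 := summable_durfeeTerm hp 1 (n + 1)
  rw [← tsum_durfeeTerm_zero hp n, s0.tsum_eq_zero_add, s1.tsum_eq_zero_add, h0, tsum_congr hs,
    ((summable_nat_add_iff 1).2 s1).tsum_add (s2.mul_left _), tsum_mul_left]
  ring

/-! ### Laurent coefficients of the products of Euler series -/

/-- The coefficient `∑_i q ^ (e i + e (i + m)) / ((p; p)_i (p; p)_{i+m})` of `z ^ m` in the product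
of `∑_j q ^ (e j) z ^ j / (p; p)_j` and `∑_i q ^ (e i) z ^ (-i) / (p; p)_i`. -/
noncomputable def laurentCoeff (p q : ℂ) (e : ℕ → ℕ) (m : ℕ) : ℂ :=
  ∑' i, q ^ (e i + e (i + m)) / (qShifted p p i * qShifted p p (i + m))

lemma laurentCoeff_sq {q : ℂ} (hq : ‖q ^ 2‖ < 1) (m : ℕ) :
    laurentCoeff (q ^ 2) q (fun i => i ^ 2) m
      = q ^ (m ^ 2) * (qShiftedInf (q ^ 2) (q ^ 2))⁻¹ := by
  rw [← tsum_durfeeTerm_zero hq m, ← tsum_mul_left]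
  refine tsum_congr fun i => ?_
  rw [durfeeTerm, ← mul_div_assoc, ← pow_mul, ← pow_add]
  ring_nf

lemma triangle_succ (m : ℕ) : (m + 1) * (m + 1 + 1) / 2 = m * (m + 1) / 2 + (m + 1) := by
  rw [show (m + 1) * (m + 1 + 1) = m * (m + 1) + (m + 1) * 2 by ring,
    Nat.add_mul_div_right _ _ two_pos]

lemma triangle_add_triangle (i m : ℕ) :
    i * (i + 1) / 2 + (i + m) * (i + m + 1) / 2 = m * (m + 1) / 2 + i * (i + m + 1) := by
  induction i with
  | zero => simp
  | succ i ih =>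
    rw [show i + 1 + m = i + m + 1 by ring, triangle_succ, triangle_succ]
    linarith

lemma le_triangle (i : ℕ) : i ≤ i * (i + 1) / 2 := by
  rw [Nat.le_div_iff_mul_le two_pos]
  nlinarith [Nat.le_self_pow two_ne_zero i]

lemma laurentCoeff_triangle (q : ℂ) (m : ℕ) :
    laurentCoeff q q (fun i => i * (i + 1) / 2) m
      = q ^ (m * (m + 1) / 2) * ∑' i, durfeeTerm q 1 m i := by
  rw [← tsum_mul_left]
  refine tsum_congr fun i => ?_
  rw [durfeeTerm, ← mul_div_assoc, ← pow_add, triangle_add_triangle]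

lemma laurentCoeff_triangle_add_succ {q : ℂ} (hq : ‖q‖ < 1) (m : ℕ) :
    laurentCoeff q q (fun i => i * (i + 1) / 2) m
      + laurentCoeff q q (fun i => i * (i + 1) / 2) (m + 1)
      = q ^ (m * (m + 1) / 2) * (qShiftedInf q q)⁻¹ := by
  rw [laurentCoeff_triangle, laurentCoeff_triangle, ← tsum_durfeeTerm_one_add hq m, triangle_succ,
    pow_add]
  ring

/-! ### Binomial weights -/

/-- The weight `(m / k) * (m + k - 1).choose (2 k - 1)` of the double series, at `m = k + t`. -/
noncomputable def doubleWeight (k t : ℕ) : ℂ :=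
  (((k + t : ℕ) : ℂ) / k) * (Nat.choose (k + t + k - 1) (2 * k - 1) : ℂ)

/-- The weight `(2 n + 1) / (2 k + 1) * (n + k).choose (2 k)` of the first single series, at
`n = k + t`. -/
noncomputable def singleWeight (k t : ℕ) : ℂ :=
  (2 * ((k + t : ℕ) : ℂ) + 1) / (2 * (k : ℂ) + 1) * (Nat.choose (k + t + k) (2 * k) : ℂ)

lemma singleWeight_zero (k : ℕ) : singleWeight k 0 = 1 := by
  have h : (2 * (k : ℂ) + 1) ≠ 0 := by exact_mod_cast Nat.succ_ne_zero (2 * k)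
  simp [singleWeight, ← two_mul, h]

lemma doubleWeight_zero {k : ℕ} (hk : 0 < k) : doubleWeight k 0 = 1 := by
  have h : (k : ℂ) ≠ 0 := by exact_mod_cast hk.ne'
  simp [doubleWeight, ← two_mul, h]

/-- The single weights are the partial sums of the double weights. -/
lemma singleWeight_succ {k : ℕ} (hk : 0 < k) (t : ℕ) :
    singleWeight k (t + 1) = singleWeight k t + doubleWeight k (t + 1) := by
  obtain ⟨l, rfl⟩ := Nat.exists_eq_add_of_lt hk
  simp only [singleWeight, doubleWeight, zero_add]
  have c2 := Nat.choose_succ_right_eq (2 * l + t + 2) (2 * l + 1)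
  have c3 := Nat.choose_succ_succ' (2 * l + t + 2) (2 * l + 1)
  rw [show 2 * l + t + 2 - (2 * l + 1) = t + 1 by omega] at c2
  rw [show l + 1 + (t + 1) + (l + 1) = 2 * l + t + 2 + 1 by ring,
    show l + 1 + t + (l + 1) = 2 * l + t + 2 by ring,
    show 2 * (l + 1) - 1 = 2 * l + 1 by omega, show 2 * l + t + 2 + 1 - 1 = 2 * l + t + 2 by omega,
    show 2 * (l + 1) = 2 * l + 1 + 1 by ring, c3]
  have h1 : ((l : ℂ) + 1) ≠ 0 := by exact_mod_cast l.succ_ne_zero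
  have h2 : (2 * ((l : ℂ) + 1) + 1) ≠ 0 := by exact_mod_cast Nat.succ_ne_zero (2 * (l + 1))
  have c2' : (Nat.choose (2 * l + t + 2) (2 * l + 1 + 1) : ℂ) * (2 * l + 1 + 1)
      = Nat.choose (2 * l + t + 2) (2 * l + 1) * (t + 1) := by exact_mod_cast c2
  push_cast
  field_simp
  linear_combination c2'

/-- The weights `2 n / (n + k) * (n + k).choose (2 k)` of the second single series are the weights
of the double series. -/
lemma singleTermC_weight {k : ℕ} (hk : 0 < k) (t : ℕ) :
    2 * ((k + t : ℕ) : ℂ) / (((k + t : ℕ) : ℂ) + (k : ℂ)) * (Nat.choose (k + t + k) (2 * k) : ℂ)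
      = doubleWeight k t := by
  obtain ⟨l, rfl⟩ := Nat.exists_eq_add_of_lt hk
  simp only [doubleWeight, zero_add]
  have c := Nat.add_one_mul_choose_eq (2 * l + t + 1) (2 * l + 1)
  rw [show l + 1 + t + (l + 1) = 2 * l + t + 1 + 1 by ring,
    show 2 * (l + 1) - 1 = 2 * l + 1 by omega, Nat.add_sub_cancel,
    show 2 * (l + 1) = 2 * l + 1 + 1 by ring]
  have h1 : ((l : ℂ) + 1) ≠ 0 := by exact_mod_cast l.succ_ne_zero
  have h2 : ((l : ℂ) + 1 + t + (l + 1)) ≠ 0 := by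
    exact_mod_cast (by omega : l + 1 + t + (l + 1) ≠ 0)
  have c' : (2 * l + t + 1 + 1 : ℂ) * Nat.choose (2 * l + t + 1) (2 * l + 1)
      = Nat.choose (2 * l + t + 1 + 1) (2 * l + 1 + 1) * (2 * l + 1 + 1) := by exact_mod_cast c
  push_cast
  field_simp
  linear_combination -((l : ℂ) + 1 + t) * c'

/-- Domination by a single binomial coefficient, so that weighted geometric series converge by
`summable_choose_mul_geometric_of_norm_lt_one`. -/
lemma norm_singleWeight_le (k t : ℕ) :
    ‖singleWeight k t‖ ≤ 2 * (Nat.choose (t + (2 * k + 1)) (2 * k + 1) : ℝ) := by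
  have c := Nat.add_one_mul_choose_eq (t + 2 * k) (2 * k)
  have c' : (t + 2 * k + 1 : ℝ) * Nat.choose (t + 2 * k) (2 * k)
      = Nat.choose (t + (2 * k + 1)) (2 * k + 1) * (2 * k + 1) := by exact_mod_cast c
  have h : singleWeight k t = (((2 * (k + t) + 1 : ℝ) / (2 * k + 1)
      * Nat.choose (t + 2 * k) (2 * k) : ℝ) : ℂ) := by
    rw [singleWeight, show k + t + k = t + 2 * k by ring]
    push_cast
    ring
  rw [h, Complex.norm_real, Real.norm_of_nonneg (by positivity), div_mul_eq_mul_div,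
    div_le_iff₀ (by positivity), mul_assoc, ← c', ← mul_assoc]
  gcongr
  linarith [(Nat.cast_nonneg k : (0 : ℝ) ≤ k)]

lemma exists_singleWeight_eq_ofReal (k t : ℕ) : ∃ x : ℝ, 0 ≤ x ∧ singleWeight k t = x :=
  ⟨(2 * ((k + t : ℕ) : ℝ) + 1) / (2 * (k : ℝ) + 1) * (Nat.choose (k + t + k) (2 * k) : ℝ),
    by positivity, by rw [singleWeight]; push_cast; rfl⟩

lemma exists_doubleWeight_eq_ofReal (k t : ℕ) : ∃ x : ℝ, 0 ≤ x ∧ doubleWeight k t = x :=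
  ⟨(((k + t : ℕ) : ℝ) / k) * (Nat.choose (k + t + k - 1) (2 * k - 1) : ℝ),
    by positivity, by rw [doubleWeight]; push_cast; rfl⟩

lemma norm_doubleWeight_le {k : ℕ} (hk : 0 < k) (t : ℕ) :
    ‖doubleWeight k t‖ ≤ 2 * (Nat.choose (t + (2 * k + 1)) (2 * k + 1) : ℝ) := by
  refine le_trans ?_ (norm_singleWeight_le k t)
  cases t with
  | zero => rw [doubleWeight_zero hk, singleWeight_zero]
  | succ t =>
    -- all weights are nonnegative reals, so norms add up in `singleWeight_succ`
    obtain ⟨x, hx, hsx⟩ := exists_singleWeight_eq_ofReal k t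
    obtain ⟨y, hy, hdy⟩ := exists_doubleWeight_eq_ofReal k (t + 1)
    rw [singleWeight_succ hk, hsx, hdy, ← Complex.ofReal_add, Complex.norm_real, Complex.norm_real,
      Real.norm_of_nonneg hy, Real.norm_of_nonneg (add_nonneg hx hy)]
    exact le_add_of_nonneg_left hx

/-! ### Summability and rearrangement -/

lemma summable_choose_mul_pow {q : ℂ} (hq : ‖q‖ < 1) (K : ℕ) :
    Summable fun t : ℕ => 2 * (Nat.choose (t + K) K : ℝ) * ‖q‖ ^ t := by
  simpa [mul_assoc] using
    (summable_choose_mul_geometric_of_norm_lt_one K (r := ‖q‖) (by simpa using hq)).mul_left 2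

lemma summable_weight_mul_pow {q : ℂ} (hq : ‖q‖ < 1) {K : ℕ} {w : ℕ → ℂ}
    (hw : ∀ t, ‖w t‖ ≤ 2 * (Nat.choose (t + K) K : ℝ)) {e : ℕ → ℕ} (he : ∀ t, t ≤ e t) :
    Summable fun t => w t * q ^ e t := by
  refine Summable.of_norm_bounded (summable_choose_mul_pow hq K) fun t => ?_
  rw [norm_mul, norm_pow]
  exact mul_le_mul (hw t) (pow_le_pow_of_le_one (norm_nonneg _) hq.le (he t)) (by positivity)
    (by positivity)

lemma summable_weight_mul_pow_div {p q : ℂ} (hp : ‖p‖ < 1) (hq : ‖q‖ < 1) {K : ℕ} {w : ℕ → ℂ}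
    (hw : ∀ t, ‖w t‖ ≤ 2 * (Nat.choose (t + K) K : ℝ)) {e : ℕ → ℕ} (he : ∀ i, i ≤ e i) (k : ℕ) :
    Summable fun x : ℕ × ℕ => w x.2 * (q ^ (e x.1 + e (x.1 + (k + x.2)))
      / (qShifted p p x.1 * qShifted p p (x.1 + (k + x.2)))) := by
  obtain ⟨C, hC, h⟩ := exists_norm_pow_div_qShifted_mul_le hp
  have hs := ((summable_geometric_of_lt_one (norm_nonneg _) hq).mul_left C).mul_of_nonneg
    (summable_choose_mul_pow hq K) (fun _ => by positivity) (fun _ => by positivity)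
  refine Summable.of_norm_bounded hs fun ⟨i, t⟩ => ?_
  have h1 := h q (e i + e (i + (k + t))) (i + t) i (i + (k + t)) hq
    (by linarith [he i, he (i + (k + t))])
  rw [norm_mul]
  calc _ ≤ 2 * (Nat.choose (t + K) K : ℝ) * (C * ‖q‖ ^ (i + t)) :=
        mul_le_mul (hw t) h1 (norm_nonneg _) (by positivity)
    _ = _ := by rw [pow_add]; ring

/-- The shift `t ↦ a + t` as an equivalence from `ℕ` onto the naturals that are at least `a`. -/
def natEquivIci (a : ℕ) : ℕ ≃ Set.Ici a where
  toFun t := ⟨a + t, Nat.le_add_right a t⟩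
  invFun n := n - a
  left_inv t := Nat.add_sub_cancel_left a t
  right_inv n := Subtype.ext (Nat.add_sub_cancel' n.2)

lemma summable_Ici_iff {f : ℕ → ℂ} (a : ℕ) :
    (Summable fun n : Set.Ici a => f n) ↔ Summable fun t => f (a + t) :=
  ((natEquivIci a).summable_iff (f := fun n : Set.Ici a => f n)).symm

lemma tsum_Ici (f : ℕ → ℂ) (a : ℕ) : ∑' n : Set.Ici a, f n = ∑' t, f (a + t) :=
  ((natEquivIci a).tsum_eq fun n : Set.Ici a => f n).symm

lemma summable_sigma_Ici {G : ℕ → ℕ → ℂ} {k : ℕ}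
    (hG : Summable fun x : ℕ × ℕ => G x.1 (x.1 + (k + x.2))) :
    Summable fun x : (Σ i : ℕ, Set.Ici (i + k)) => G x.1 x.2 := by
  let φ : ℕ × ℕ ≃ (Σ i : ℕ, Set.Ici (i + k)) :=
    (Equiv.sigmaEquivProd ℕ ℕ).symm.trans (Equiv.sigmaCongrRight fun i => natEquivIci (i + k))
  rw [← φ.summable_iff]
  refine hG.congr fun x => ?_
  rw [← add_assoc]
  rfl

lemma tsum_tsum_Ici {G : ℕ → ℕ → ℂ} {k : ℕ}
    (hG : Summable fun x : ℕ × ℕ => G x.1 (x.1 + (k + x.2))) :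
    ∑' i : ℕ, ∑' j : Set.Ici (i + k), G i j = ∑' t, ∑' i, G i (i + (k + t)) := by
  simp only [tsum_Ici, add_assoc]
  exact (Summable.tsum_comm (f := fun t i => G i (i + (k + t))) hG.prod_symm)

/-! ### The two identities -/

lemma norm_neg_one_pow_mul (t : ℕ) (z : ℂ) : ‖(-1) ^ t * z‖ = ‖z‖ := by simp

/-- A double series of the shape common to both identities converges absolutely, and summing along
the diagonals `j - i = k + t` expresses it through Laurent coefficients. -/
lemma summable_and_tsum_eq_tsum_laurentCoeff {p q : ℂ} (hp : ‖p‖ < 1) (hq : ‖q‖ < 1) {k : ℕ} (hk : 0 < k) {e : ℕ → ℕ}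
    (he : ∀ i, i ≤ e i) {G : ℕ → ℕ → ℂ}
    (hG : ∀ i j, G i j = (-1) ^ (j - i - k) * (((j : ℂ) - (i : ℂ)) / (k : ℂ))
      * (Nat.choose (j - i + k - 1) (2 * k - 1) : ℂ)
      * (q ^ (e i + e j) / (qShifted p p i * qShifted p p j))) :
    (Summable fun x : (Σ i : ℕ, Set.Ici (i + k)) => G x.1 x.2) ∧
      ∑' i : ℕ, ∑' j : Set.Ici (i + k), G i j =
        ∑' t, (-1) ^ t * doubleWeight k t * laurentCoeff p q e (k + t) := by
  have hG' : ∀ i t, G i (i + (k + t)) = (-1) ^ t * doubleWeight k t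
      * (q ^ (e i + e (i + (k + t))) / (qShifted p p i * qShifted p p (i + (k + t)))) := by
    intro i t
    rw [hG, doubleWeight, Nat.add_sub_cancel_left, Nat.add_sub_cancel_left]
    push_cast
    ring
  have hs : Summable fun x : ℕ × ℕ => G x.1 (x.1 + (k + x.2)) := by
    simp only [hG']
    exact summable_weight_mul_pow_div hp hq (K := 2 * k + 1)
      (w := fun t => (-1) ^ t * doubleWeight k t)
      (fun t => (norm_neg_one_pow_mul t _).trans_le (norm_doubleWeight_le hk t)) he k
  refine ⟨summable_sigma_Ici hs, ?_⟩
  rw [tsum_tsum_Ici hs]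
  simp only [hG', tsum_mul_left, laurentCoeff]

/-- Summation by parts, using that the single weights are the partial sums of the double ones. -/
lemma tsum_singleWeight_mul_add_succ {k : ℕ} (hk : 0 < k) {c : ℕ → ℂ}
    (hs : Summable fun t => (-1) ^ t * singleWeight k t * c t)
    (hd : Summable fun t => (-1) ^ t * doubleWeight k t * c t) :
    ∑' t, (-1) ^ t * singleWeight k t * (c t + c (t + 1))
      = ∑' t, (-1) ^ t * doubleWeight k t * c t := by
  have hs1 := (summable_nat_add_iff 1).2 hs
  have hd1 := (summable_nat_add_iff 1).2 hd
  have h : ∀ t, (-1) ^ t * singleWeight k t * (c t + c (t + 1)) =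
      (-1) ^ t * singleWeight k t * c t + ((-1) ^ (t + 1) * doubleWeight k (t + 1) * c (t + 1)
        - (-1) ^ (t + 1) * singleWeight k (t + 1) * c (t + 1)) := fun t => by
    rw [singleWeight_succ hk]
    ring
  rw [tsum_congr h, hs.tsum_add (hd1.sub hs1), hd1.tsum_sub hs1, hs.tsum_eq_zero_add,
    hd.tsum_eq_zero_add, singleWeight_zero, doubleWeight_zero hk]
  ring

theorem theorem2p3 (q : ℂ) (hq : ‖q‖ < 1) (k : ℕ) (hk : 0 < k) :
    -- first identity: everything in it converges, `(q; q)_∞ ≠ 0`, and the two sides agree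
    ((Multipliable fun i : ℕ => 1 - q * q ^ i) ∧ qShiftedInf q q ≠ 0 ∧
      (Summable fun n : Set.Ici k => singleTermA k q n) ∧
      (Summable fun p : (Σ i : ℕ, Set.Ici (i + k)) => doubleTermA k q p.1 p.2) ∧
      1 / qShiftedInf q q * ∑' n : Set.Ici k, singleTermA k q n =
        ∑' i : ℕ, ∑' j : Set.Ici (i + k), doubleTermA k q i j) ∧
    -- second identity, likewise
    ((Multipliable fun i : ℕ => 1 - q ^ 2 * (q ^ 2) ^ i) ∧ qShiftedInf (q ^ 2) (q ^ 2) ≠ 0 ∧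
      (Summable fun n : Set.Ici k => singleTermC k q n) ∧
      (Summable fun p : (Σ i : ℕ, Set.Ici (i + k)) => doubleTermC k q p.1 p.2) ∧
      1 / qShiftedInf (q ^ 2) (q ^ 2) * ∑' n : Set.Ici k, singleTermC k q n =
        ∑' i : ℕ, ∑' j : Set.Ici (i + k), doubleTermC k q i j) := by
  have hq2 : ‖q ^ 2‖ < 1 := by
    rw [norm_pow]; exact pow_lt_one₀ (norm_nonneg _) hq two_ne_zero
  have hsw : ∀ t, ‖(-1) ^ t * singleWeight k t‖
      ≤ 2 * (Nat.choose (t + (2 * k + 1)) (2 * k + 1) : ℝ) := fun t =>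
    (norm_neg_one_pow_mul t _).trans_le (norm_singleWeight_le k t)
  have hdw : ∀ t, ‖(-1) ^ t * doubleWeight k t‖
      ≤ 2 * (Nat.choose (t + (2 * k + 1)) (2 * k + 1) : ℝ) := fun t =>
    (norm_neg_one_pow_mul t _).trans_le (norm_doubleWeight_le hk t)
  constructor
  · have hA : ∀ t, singleTermA k q (k + t)
        = (-1) ^ t * singleWeight k t * q ^ ((k + t) * (k + t + 1) / 2) := fun t => by
      rw [singleTermA, singleWeight, Nat.add_sub_cancel_left]
      ring
    have hsum : ∀ {w : ℕ → ℂ},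
        (∀ t, ‖w t‖ ≤ 2 * (Nat.choose (t + (2 * k + 1)) (2 * k + 1) : ℝ)) →
        Summable fun t => w t * laurentCoeff q q (fun i => i * (i + 1) / 2) (k + t) := fun hw => by
      have := (summable_weight_mul_pow_div hq hq hw le_triangle k).prod_symm.prod
      simp only [Prod.swap_prod_mk, tsum_mul_left] at this
      exact this
    obtain ⟨hd, hde⟩ :=
      summable_and_tsum_eq_tsum_laurentCoeff hq hq hk le_triangle (G := doubleTermA k q) fun i j => rfl
    refine ⟨multipliable_one_sub_mul_pow hq, qShiftedInf_ne_zero hq, ?_, hd, ?_⟩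
    · rw [summable_Ici_iff]
      simp only [hA]
      exact summable_weight_mul_pow hq hsw
        fun t => (Nat.le_add_left t k).trans (le_triangle (k + t))
    · rw [hde, tsum_Ici, ← tsum_mul_left, ← tsum_singleWeight_mul_add_succ hk (hsum hsw) (hsum hdw)]
      refine tsum_congr fun t => ?_
      rw [hA, ← add_assoc k t 1, laurentCoeff_triangle_add_succ hq]
      ring
  · have hC : ∀ t, singleTermC k q (k + t)
        = (-1) ^ t * doubleWeight k t * q ^ ((k + t) ^ 2) := fun t => by
      rw [singleTermC, ← singleTermC_weight hk, Nat.add_sub_cancel_left]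
      ring
    have he : ∀ i : ℕ, i ≤ i ^ 2 := Nat.le_self_pow two_ne_zero
    obtain ⟨hd, hde⟩ :=
      summable_and_tsum_eq_tsum_laurentCoeff hq2 hq hk he (G := doubleTermC k q) fun i j => rfl
    refine ⟨multipliable_one_sub_mul_pow hq2, qShiftedInf_ne_zero hq2, ?_, hd, ?_⟩
    · rw [summable_Ici_iff]
      simp only [hC]
      exact summable_weight_mul_pow hq hdw fun t => (Nat.le_add_left t k).trans (he (k + t))
    · rw [hde, tsum_Ici, ← tsum_mul_left]
      refine tsum_congr fun t => ?_
      rw [hC, laurentCoeff_sq hq2]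
      ring
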